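/- Let $(\gamma_k)_{k\ge 0}$ be a sequence of complex numbers, let $D=\frac{d}{dx}$, and let $\phi(D)=\sum_{k=0}^{\infty}\frac{\gamma_k}{k!}D^k$, a linear operator on $\mathbb{C}[x]$ (applied to a polynomial, the sum is finite). Put $P_n(x)=\phi(D)x^n$ for $n\ge 0$. A moment functional is a linear functional $\mathcal{L}:\mathbb{C}[x]\to\mathbb{C}$. It is positive-definite if $\mathcal{L}[\pi(x)]>0$ for every polynomial $\pi$ that is not identically zero and is real and non-negative at all real $x$. A sequence $\{P_n(x)\}_{n\ge0}$ is an orthogonal polynomial sequence (OPS) with respect to $\mathcal{L}$ if, for all $m,n\ge 0$: $\deg P_n=n$; $\mathcal{L}[P_mP_n]=0$ when $m\ne n$; and $\mathcal{L}[P_n^2]\neq 0$. For real $\alpha$, the generalized Hermite polynomials are defined by $H_0^\alpha(x)=1$, $H_1^\alpha(x)=x$, and $H_n^\alpha(x)=xH_{n-1}^\alpha(x)-\alpha(n-1)H_{n-2}^\alpha(x)$ for $n\ge 2$. Theorem. The sequence $\{P_n(x)\}_{n\ge0}$ is an OPS with respect to some positive-definite moment functional $\mathcal{L}$ if and only if $\gamma_0\neq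 0$ and there are real numbers $\alpha,\beta$ with $\alpha>0$ such that $P_n(x)=\gamma_0H_n^{\alpha}(x-\beta)$ for all $n\ge 0$. In that case, for all $n\ge0$, $$\gamma_0H_n^{\alpha}(x-\beta)=\gamma_0\,e^{-\frac{\alpha}{2}D^2-\beta D}\,x^n,\qquad\text{where } e^{T}p=\sum_{j=0}^\infty \frac{1}{j!}T^jp,$$ and $\phi(D)$ preserves real-rootedness: if $p\in\mathbb{C}[x]$ is a nonzero polynomial all of whose complex roots are real, then $\phi(D)p$ is a nonzero polynomial all of whose complex roots are real. -/

import Mathlib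

open Polynomial
open scoped ComplexOrder

/-- A moment functional is a `ℂ`-linear functional `𝓛` on `ℂ[x]`. The sequence `P` is an orthogonal
polynomial sequence for `𝓛` (the products are not conjugated). -/
structure IsOPS (𝓛 : ℂ[X] →ₗ[ℂ] ℂ) (P : ℕ → ℂ[X]) : Prop where
  degree_eq : ∀ n, (P n).degree = n
  orthogonal : ∀ m n, m ≠ n → 𝓛 (P m * P n) = 0
  sq_ne_zero : ∀ n, 𝓛 (P n ^ 2) ≠ 0

/-- `𝓛[π] > 0` for every polynomial `π ≠ 0` that is non-negative at all real points. In the order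
on `ℂ` used here, `0 ≤ z` means that `z` is a non-negative real, and `0 < z` that it is a
positive real. -/
def IsPositiveDefinite (𝓛 : ℂ[X] →ₗ[ℂ] ℂ) : Prop :=
  ∀ p : ℂ[X], p ≠ 0 → (∀ x : ℝ, 0 ≤ p.eval (x : ℂ)) → 0 < 𝓛 p

/-- Differentiation `D` as a linear operator on `ℂ[x]`. -/
noncomputable abbrev opD : Module.End ℂ ℂ[X] := derivative

theorem finite_support_smul_opD_pow (a : ℕ → ℂ) (p : ℂ[X]) :
    (Function.support fun k => a k • (opD ^ k) p).Finite := by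
  refine (Set.finite_Iic p.natDegree).subset fun k hk => ?_
  by_contra h
  apply hk
  have : (opD ^ k) p = 0 := by
    rw [Module.End.pow_apply]
    exact iterate_derivative_eq_zero (by simpa using h)
  simp [this]

/-- The operator `φ(D) = ∑_{k ≥ 0} (γ_k / k!) D^k` on `ℂ[x]`, for an arbitrary complex sequence `γ`;
applied to a polynomial, the sum has only finitely many non-zero terms. -/
noncomputable def diffOp (γ : ℕ → ℂ) : Module.End ℂ ℂ[X] where
  toFun p := ∑ᶠ k : ℕ, (γ k / (k.factorial : ℂ)) • (opD ^ k) p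
  map_add' p q := by
    simp only [map_add, smul_add]
    exact finsum_add_distrib (finite_support_smul_opD_pow _ p) (finite_support_smul_opD_pow _ q)
  map_smul' c p := by
    simp only [map_smul, RingHom.id_apply]
    rw [smul_finsum' c (finite_support_smul_opD_pow _ p)]
    exact finsum_congr fun k => smul_comm _ _ _

/-- `e^T p = ∑_{j ≥ 0} T^j p / j!`, for operators `T` on `ℂ[x]` for which only finitely many
`T^j p` are non-zero, such as polynomials in `D` without constant term. -/
noncomputable def expOp (T : Module.End ℂ ℂ[X]) (p : ℂ[X]) : ℂ[X] :=
  ∑ᶠ j : ℕ, (1 / (j.factorial : ℂ)) • (T ^ j) p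

/-- The generalized Hermite polynomials `H_n^α`: `H_0 = 1`, `H_1 = x`,
`H_n = x H_{n-1} - α (n-1) H_{n-2}` for `n ≥ 2`. -/
noncomputable def genHermite (α : ℝ) : ℕ → ℂ[X]
  | 0 => 1
  | 1 => X
  | n + 2 => X * genHermite α (n + 1) - C ((α : ℂ) * ((n : ℂ) + 1)) * genHermite α n

/-- All complex roots are real; the zero polynomial does not count as real-rooted. -/
def IsRealRooted (p : ℂ[X]) : Prop := ∀ z : ℂ, p.eval z = 0 → z.im = 0

def PreservesRealRootedness (T : Module.End ℂ ℂ[X]) : Prop :=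
  ∀ p : ℂ[X], IsRealRooted p → IsRealRooted (T p)

/-! Since `φ(D)` commutes with `D`, the `P_n` form an Appell sequence. Normalise to `p_n = P_n /
γ_0`. The defect of the Hermite recurrence at `n + 1` has derivative `n + 2` times the defect at
`n`, so inductively it is constant, and applying `𝓛` shows that the constant is zero
(`exists_eq_shiftedHermite`). Positive-definiteness makes `β` real and `α` positive. Conversely, the
Gaussian of mean `β` and variance `α` is a suitable functional, by integration by parts. With `T =
-(α/2) D² - β D`, the commutator `[T, X] = -α D - β` gives `e^T X = (X - β - α D) e^T`, which is the
Hermite raising relation; hence `φ(D) = γ_0 e^T`. For real roots, `e^T` is the limit of `(1 +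
T/n)^n`, and `1 + T/n` splits into real factors `1 - a D`, each preserving real-rootedness. A lower
bound off the real axis, uniform in `n`, carries this to the limit. -/

/-! ### Shifted Hermite polynomials -/

/-- The Hermite polynomials centred at `β`. -/
noncomputable def shiftedHermite (α β : ℝ) (n : ℕ) : ℂ[X] :=
  (genHermite α n).comp (X - C (β : ℂ))

theorem shiftedHermite_zero (α β : ℝ) : shiftedHermite α β 0 = 1 := by
  simp [shiftedHermite, genHermite]

theorem shiftedHermite_one (α β : ℝ) : shiftedHermite α β 1 = X - C (β : ℂ) := by
  simp [shiftedHermite, genHermite]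

theorem shiftedHermite_add_two (α β : ℝ) (n : ℕ) :
    shiftedHermite α β (n + 2) = (X - C (β : ℂ)) * shiftedHermite α β (n + 1) -
      C ((α : ℂ) * ((n : ℂ) + 1)) * shiftedHermite α β n := by
  simp [shiftedHermite, genHermite]

theorem derivative_shiftedHermite_succ (α β : ℝ) (n : ℕ) :
    derivative (shiftedHermite α β (n + 1)) = ((n : ℂ[X]) + 1) * shiftedHermite α β n := by
  induction n using Nat.twoStepInduction with
  | zero => simp [shiftedHermite_zero, shiftedHermite_one]
  | one => simp [shiftedHermite_zero, shiftedHermite_one, shiftedHermite_add_two]; ring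
  | more n ih₁ ih₂ =>
    rw [shiftedHermite_add_two, derivative_sub, derivative_mul, derivative_C_mul, ih₂, ih₁,
      shiftedHermite_add_two]
    simp
    ring

/-- The raising operator `X - β - α D`: the form that both `expOp_X_mul` and Gaussian integration by
parts produce. -/
theorem shiftedHermite_succ (α β : ℝ) (n : ℕ) :
    shiftedHermite α β (n + 1) = (X - C (β : ℂ)) * shiftedHermite α β n -
      C (α : ℂ) * derivative (shiftedHermite α β n) := by
  cases n with
  | zero => simp [shiftedHermite_zero, shiftedHermite_one]
  | succ n =>
    rw [shiftedHermite_add_two, derivative_shiftedHermite_succ]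
    simp
    ring

theorem shiftedHermite_monic_natDegree (α β : ℝ) (n : ℕ) :
    (shiftedHermite α β n).Monic ∧ (shiftedHermite α β n).natDegree = n := by
  induction n with
  | zero => simp [shiftedHermite_zero]
  | succ n ih =>
    have hm : ((X - C (β : ℂ)) * shiftedHermite α β n).Monic := (monic_X_sub_C _).mul ih.1
    have hd : ((X - C (β : ℂ)) * shiftedHermite α β n).degree = ((n + 1 : ℕ) : WithBot ℕ) := by
      rw [degree_mul, degree_X_sub_C, degree_eq_natDegree ih.1.ne_zero, ih.2]
      push_cast
      ring
    have hlt : (C (α : ℂ) * derivative (shiftedHermite α β n)).degree <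
        ((X - C (β : ℂ)) * shiftedHermite α β n).degree := by
      rw [hd]
      refine degree_le_natDegree.trans_lt (Nat.cast_lt.mpr (Nat.lt_succ_of_le ?_))
      exact (natDegree_C_mul_le _ _).trans ((natDegree_derivative_le _).trans (by omega))
    rw [shiftedHermite_succ]
    refine ⟨hm.sub_of_left hlt, natDegree_eq_of_degree_eq_some ?_⟩
    rw [degree_sub_eq_left_of_degree_lt hlt, hd]

/-! ### Operators with constant coefficients -/

theorem derivative_diffOp (γ : ℕ → ℂ) (p : ℂ[X]) :
    derivative (diffOp γ p) = diffOp γ (derivative p) := by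
  change derivative (∑ᶠ k : ℕ, (γ k / (k.factorial : ℂ)) • (opD ^ k) p) =
    ∑ᶠ k : ℕ, (γ k / (k.factorial : ℂ)) • (opD ^ k) (derivative p)
  rw [map_finsum _ (finite_support_smul_opD_pow _ p)]
  refine finsum_congr fun k => ?_
  rw [map_smul, ← Module.End.mul_apply (opD ^ k), ← pow_succ, pow_succ']
  rfl

theorem diffOp_one (γ : ℕ → ℂ) : diffOp γ 1 = C (γ 0) := by
  change ∑ᶠ k : ℕ, (γ k / (k.factorial : ℂ)) • (opD ^ k) (1 : ℂ[X]) = C (γ 0)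
  rw [finsum_eq_single _ 0]
  · simp [smul_eq_C_mul]
  · intro k hk
    obtain ⟨k, rfl⟩ := Nat.exists_eq_succ_of_ne_zero hk
    simp [pow_succ]

theorem derivative_diffOp_X_pow_succ (γ : ℕ → ℂ) (n : ℕ) :
    derivative (diffOp γ (X ^ (n + 1))) = ((n : ℂ[X]) + 1) * diffOp γ (X ^ n) := by
  have h : derivative (X ^ (n + 1) : ℂ[X]) = ((n : ℂ) + 1) • X ^ n := by
    simp [smul_eq_C_mul]
  rw [derivative_diffOp, h, map_smul, smul_eq_C_mul]
  simp

/-! ### Necessity -/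

theorem IsPositiveDefinite.map_one_pos {𝓛 : ℂ[X] →ₗ[ℂ] ℂ} (h : IsPositiveDefinite 𝓛) :
    0 < 𝓛 1 :=
  h 1 one_ne_zero (by simp)

theorem IsPositiveDefinite.map_X_sub_C_sq_pos {𝓛 : ℂ[X] →ₗ[ℂ] ℂ} (h : IsPositiveDefinite 𝓛)
    (b : ℝ) : 0 < 𝓛 ((X - C (b : ℂ)) ^ 2) := by
  refine h _ (pow_ne_zero _ (X_sub_C_ne_zero _)) fun x => ?_
  simp only [eval_pow, eval_sub, eval_X, eval_C]
  exact_mod_cast sq_nonneg (x - b)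

/-- `2X = X² + 1 - (X - 1)²`, and `𝓛` is real on each of the three squares. -/
theorem IsPositiveDefinite.im_map_X {𝓛 : ℂ[X] →ₗ[ℂ] ℂ} (h : IsPositiveDefinite 𝓛) :
    (𝓛 X).im = 0 := by
  have h₁ := (Complex.lt_def.mp h.map_one_pos).2
  have h₂ := (Complex.lt_def.mp (h.map_X_sub_C_sq_pos 1)).2
  have h₃ := (Complex.lt_def.mp (h.map_X_sub_C_sq_pos 0)).2
  have e : (X - C ((1 : ℝ) : ℂ)) ^ 2 = (X - C ((0 : ℝ) : ℂ)) ^ 2 - (2 : ℂ) • X + (1 : ℂ[X]) := by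
    simp [smul_eq_C_mul, C_ofNat]
    ring
  rw [e, map_add, map_sub, map_smul] at h₂
  simp at h₁ h₂ h₃
  linarith

/-- A monic Appell sequence which is orthogonal for a positive-definite functional is a sequence
of shifted Hermite polynomials. -/
theorem exists_eq_shiftedHermite {𝓛 : ℂ[X] →ₗ[ℂ] ℂ} (h𝓛 : IsPositiveDefinite 𝓛) {p : ℕ → ℂ[X]}
    (h₀ : p 0 = 1) (hD : ∀ n, derivative (p (n + 1)) = ((n : ℂ[X]) + 1) * p n)
    (horth : ∀ m n, m ≠ n → 𝓛 (p m * p n) = 0) :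
    ∃ α β : ℝ, 0 < α ∧ ∀ n, p n = shiftedHermite α β n := by
  have hone := h𝓛.map_one_pos
  have hne : 𝓛 1 ≠ 0 := hone.ne'
  have hp : ∀ n, 𝓛 (p (n + 1)) = 0 := fun n => by simpa [h₀] using horth (n + 1) 0 (by simp)
  have hC : ∀ c : ℂ, 𝓛 (C c) = c * 𝓛 1 := fun c => by
    rw [← smul_eq_mul, ← map_smul, smul_eq_C_mul, mul_one]
  have hCm : ∀ (c : ℂ) (q : ℂ[X]), 𝓛 (C c * q) = c * 𝓛 q := fun c q => by
    rw [← smul_eq_C_mul, map_smul, smul_eq_mul]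
  obtain ⟨b, hb⟩ : ∃ b : ℂ, p 1 = X - C b := by
    have := eq_C_of_derivative_eq_zero (p := X - p 1) (by simp [hD 0, h₀])
    exact ⟨(X - p 1).coeff 0, by rw [← this]; ring⟩
  have hbX : 𝓛 X = b * 𝓛 1 := by
    have := hp 0
    rw [hb, map_sub, hC] at this
    exact sub_eq_zero.mp this
  obtain ⟨β, rfl⟩ : ∃ β : ℝ, (β : ℂ) = b := by
    refine ⟨b.re, Complex.ext rfl ?_⟩
    have h₁ := Complex.lt_def.mp hone
    have h₂ := h𝓛.im_map_X
    rw [hbX, Complex.mul_im, ← h₁.2] at h₂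
    simp at h₂ h₁
    rcases h₂ with h | h
    · simp [h]
    · exact absurd h h₁.1.ne'
  obtain ⟨α, hα, hα'⟩ : ∃ α : ℝ, 0 < α ∧ 𝓛 (p 1 * p 1) = α * 𝓛 1 := by
    have h₂ := h𝓛.map_X_sub_C_sq_pos β
    rw [← hb, sq] at h₂
    have hpos := div_pos h₂ hone
    refine ⟨(𝓛 (p 1 * p 1) / 𝓛 1).re, (Complex.lt_def.mp hpos).1, ?_⟩
    rw [show ((𝓛 (p 1 * p 1) / 𝓛 1).re : ℂ) = 𝓛 (p 1 * p 1) / 𝓛 1 from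
      Complex.ext rfl (Complex.lt_def.mp hpos).2, div_mul_cancel₀ _ hne]
  -- A constant defect `c` satisfies `c * 𝓛 1 = 0`: for `n = 0` by the choice of `α`, for larger `n`
  -- because `𝓛` kills every term.
  have key : ∀ n : ℕ,
      derivative (p (n + 2) - p 1 * p (n + 1) + C ((α : ℂ) * ((n : ℂ) + 1)) * p n) = 0 →
        p (n + 2) = p 1 * p (n + 1) - C ((α : ℂ) * ((n : ℂ) + 1)) * p n := by
    intro n hd
    obtain ⟨c, hc⟩ := (⟨_, eq_C_of_derivative_eq_zero hd⟩ : ∃ c, _ = C c)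
    have hL := congrArg 𝓛 hc
    have hc0 : c = 0 := by
      rw [map_add, map_sub, hp, hCm, hC] at hL
      rcases n with _ | n
      · simpa [h₀, hα', hne] using hL.symm
      · rw [hp, horth 1 (n + 1 + 1) (by omega)] at hL
        simpa [hne] using hL.symm
    rw [hc0, C_0] at hc
    linear_combination hc
  have hrec : ∀ n : ℕ, p (n + 2) = p 1 * p (n + 1) - C ((α : ℂ) * ((n : ℂ) + 1)) * p n := by
    intro n
    induction n with
    | zero =>
      apply key
      have h1 := hD 0
      have h2 := hD 1
      simp [h₀] at h1 h2 ⊢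
      rw [h1, h2]
      ring
    | succ n ih =>
      apply key
      have h1 := hD 0
      have h2 := hD (n + 1)
      have h3 := hD (n + 2)
      have h4 := hD n
      simp only [derivative_add, derivative_sub, derivative_mul, derivative_C, h1, h2, h3, h4, h₀]
      simp at ih ⊢
      -- By the Appell property the derivative of this defect is `n + 2` times the previous one.
      linear_combination ((n : ℂ[X]) + 2) * ih
  refine ⟨α, β, hα, fun n => ?_⟩
  induction n using Nat.twoStepInduction with
  | zero => rw [h₀, shiftedHermite_zero]
  | one => rw [hb, shiftedHermite_one]
  | more n ih₁ ih₂ => rw [hrec, shiftedHermite_add_two, ih₁, ih₂, hb]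

theorem IsOPS.exists_eq_shiftedHermite {γ : ℕ → ℂ} {𝓛 : ℂ[X] →ₗ[ℂ] ℂ}
    (h𝓛 : IsPositiveDefinite 𝓛) (h : IsOPS 𝓛 fun n => diffOp γ (X ^ n)) :
    ∃ α β : ℝ, 0 < α ∧ γ 0 ≠ 0 ∧ ∀ n, diffOp γ (X ^ n) = C (γ 0) * shiftedHermite α β n := by
  have hγ : γ 0 ≠ 0 := by
    rintro h0
    have := h.sq_ne_zero 0
    simp [diffOp_one, h0] at this
  have hCC : C (γ 0) * C (γ 0)⁻¹ = 1 := by rw [← C_mul, mul_inv_cancel₀ hγ, C_1]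
  obtain ⟨α, β, hα, hp⟩ := _root_.exists_eq_shiftedHermite h𝓛
    (p := fun n => C (γ 0)⁻¹ * diffOp γ (X ^ n))
    (by rw [pow_zero, diffOp_one, mul_comm, hCC])
    (fun n => by
      simp only [derivative_C_mul, derivative_diffOp_X_pow_succ]
      ring)
    (fun m n hmn => by
      have e : C (γ 0)⁻¹ * diffOp γ (X ^ m) * (C (γ 0)⁻¹ * diffOp γ (X ^ n)) =
          ((γ 0)⁻¹ * (γ 0)⁻¹) • (diffOp γ (X ^ m) * diffOp γ (X ^ n)) := by
        rw [smul_eq_C_mul, C_mul]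
        ring
      rw [e, map_smul, h.orthogonal m n hmn, smul_zero])
  refine ⟨α, β, hα, hγ, fun n => ?_⟩
  rw [← hp, ← mul_assoc, hCC, one_mul]

/-! ### The exponential of an operator with constant coefficients -/

/-- The exponent `-(α/2) D² - β D`. -/
noncomputable def hermiteExponent (α β : ℝ) : Module.End ℂ ℂ[X] :=
  -((α : ℂ) / 2) • opD ^ 2 - (β : ℂ) • opD

theorem commute_hermiteExponent_opD (α β : ℝ) : Commute (hermiteExponent α β) opD :=
  (((Commute.refl opD).pow_left 2).smul_left _).sub_left ((Commute.refl opD).smul_left _)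

theorem hermiteExponent_eq_mul (α β : ℝ) :
    hermiteExponent α β = (-((α : ℂ) / 2) • opD - (β : ℂ) • 1) * opD := by
  rw [hermiteExponent, sub_mul, smul_mul_assoc, smul_mul_assoc, one_mul, sq]

/-- The exponent has a factor `D` that commutes with the cofactor, so its `j`-th power contains
`D^j`. -/
theorem hermiteExponent_pow_apply_eq_zero (α β : ℝ) {p : ℂ[X]} {j : ℕ} (h : p.natDegree < j) :
    (hermiteExponent α β ^ j) p = 0 := by
  have hc : Commute (-((α : ℂ) / 2) • opD - (β : ℂ) • (1 : Module.End ℂ ℂ[X])) opD :=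
    ((Commute.refl opD).smul_left _).sub_left ((Commute.one_left opD).smul_left _)
  rw [hermiteExponent_eq_mul, hc.mul_pow, Module.End.mul_apply, Module.End.pow_apply opD,
    iterate_derivative_eq_zero h, map_zero]

theorem expOp_eq_sum (α β : ℝ) {p : ℂ[X]} {N : ℕ} (h : p.natDegree < N) :
    expOp (hermiteExponent α β) p =
      ∑ j ∈ Finset.range N, (1 / (j.factorial : ℂ)) • (hermiteExponent α β ^ j) p := by
  refine finsum_eq_sum_of_support_subset _ fun j hj => ?_
  by_contra hN
  refine hj ?_
  have hN : N ≤ j := by simpa using hN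
  simp [hermiteExponent_pow_apply_eq_zero α β (h.trans_le hN)]

theorem expOp_add (α β : ℝ) (p q : ℂ[X]) : expOp (hermiteExponent α β) (p + q) =
    expOp (hermiteExponent α β) p + expOp (hermiteExponent α β) q := by
  have h := natDegree_add_le p q
  rw [expOp_eq_sum α β (N := max p.natDegree q.natDegree + 1) (by omega),
    expOp_eq_sum α β (N := max p.natDegree q.natDegree + 1) (by omega),
    expOp_eq_sum α β (N := max p.natDegree q.natDegree + 1) (by omega), ← Finset.sum_add_distrib]
  simp only [map_add, smul_add]

theorem expOp_smul (α β : ℝ) (c : ℂ) (p : ℂ[X]) : expOp (hermiteExponent α β) (c • p) =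
    c • expOp (hermiteExponent α β) p := by
  have h := natDegree_smul_le c p
  rw [expOp_eq_sum α β (N := p.natDegree + 1) (by omega),
    expOp_eq_sum α β (N := p.natDegree + 1) (by omega), Finset.smul_sum]
  refine Finset.sum_congr rfl fun j _ => ?_
  rw [map_smul, smul_comm]

theorem hermiteExponent_apply_X_mul (α β : ℝ) (p : ℂ[X]) :
    hermiteExponent α β (X * p) = X * hermiteExponent α β p +
      (-(α : ℂ) • derivative p - (β : ℂ) • p) := by
  simp [hermiteExponent, sq, smul_eq_C_mul]
  have h : (C (α : ℂ) : ℂ[X]) = 2 * C ((α : ℂ) / 2) := by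
    rw [← C_ofNat, ← C_mul]
    congr 1
    ring
  rw [h]
  ring

theorem hermiteExponent_pow_derivative (α β : ℝ) (j : ℕ) (p : ℂ[X]) :
    (hermiteExponent α β ^ j) (derivative p) = derivative ((hermiteExponent α β ^ j) p) :=
  LinearMap.congr_fun ((commute_hermiteExponent_opD α β).pow_left j).eq p

/-- `[T, X]` commutes with `T`, so `[T^(j+1), X] = (j+1) [T, X] T^j`. -/
theorem hermiteExponent_pow_succ_apply_X_mul (α β : ℝ) (j : ℕ) (p : ℂ[X]) :
    (hermiteExponent α β ^ (j + 1)) (X * p) = X * (hermiteExponent α β ^ (j + 1)) p +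
      ((j : ℂ) + 1) • (-(α : ℂ) • derivative ((hermiteExponent α β ^ j) p) -
        (β : ℂ) • (hermiteExponent α β ^ j) p) := by
  induction j with
  | zero => simp [hermiteExponent_apply_X_mul]
  | succ j ih =>
    have hs : ∀ q, (hermiteExponent α β ^ (j + 1 + 1)) q =
        hermiteExponent α β ((hermiteExponent α β ^ (j + 1)) q) := fun q => by
      rw [pow_succ', Module.End.mul_apply]
    have hs' : ∀ q, hermiteExponent α β ((hermiteExponent α β ^ j) q) =
        (hermiteExponent α β ^ (j + 1)) q := fun q => by
      rw [pow_succ', Module.End.mul_apply]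
    have hd := hermiteExponent_pow_derivative α β 1
    simp only [pow_one] at hd
    rw [hs, ih, map_add, hermiteExponent_apply_X_mul, ← hs, map_smul, map_sub, map_smul, map_smul,
      hd, hs']
    simp only [smul_eq_C_mul]
    simp
    ring

theorem expOp_X_mul (α β : ℝ) (p : ℂ[X]) :
    expOp (hermiteExponent α β) (X * p) = (X - C (β : ℂ)) * expOp (hermiteExponent α β) p -
      C (α : ℂ) * derivative (expOp (hermiteExponent α β) p) := by
  have h : (X * p).natDegree ≤ 1 + p.natDegree := natDegree_mul_le.trans (by simp)
  have e₁ := expOp_eq_sum α β (p := p) (N := p.natDegree + 1) (by omega)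
  have e₂ := expOp_eq_sum α β (p := p) (N := p.natDegree + 1 + 1) (by omega)
  have e₃ : X * expOp (hermiteExponent α β) p - expOp (hermiteExponent α β) (X * p) =
      C (β : ℂ) * expOp (hermiteExponent α β) p +
      C (α : ℂ) * derivative (expOp (hermiteExponent α β) p) := by
    -- The right side keeps one term fewer: on the left the `j = 0` terms cancel, and index `j + 1`
    -- matches `j`.
    conv_rhs => rw [e₁]
    rw [e₂, expOp_eq_sum α β (p := X * p) (N := p.natDegree + 1 + 1) (by omega),
      Finset.sum_range_succ' _ (p.natDegree + 1), Finset.sum_range_succ' _ (p.natDegree + 1),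
      derivative_sum, mul_add,
      Finset.mul_sum, Finset.mul_sum, Finset.mul_sum, add_sub_add_comm, ← Finset.sum_sub_distrib,
      ← Finset.sum_add_distrib]
    simp only [pow_zero, Module.End.one_apply, mul_smul_comm, sub_self, add_zero]
    refine Finset.sum_congr rfl fun j _ => ?_
    have hj : (1 / (j.factorial : ℂ)) = (1 / ((j + 1).factorial : ℂ)) * ((j : ℂ) + 1) := by
      have h1 : (j.factorial : ℂ) ≠ 0 := by exact_mod_cast j.factorial_ne_zero
      have h2 : (j : ℂ) + 1 ≠ 0 := by exact_mod_cast j.succ_ne_zero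
      rw [Nat.factorial_succ]
      push_cast
      field_simp
    rw [hermiteExponent_pow_succ_apply_X_mul, derivative_smul, hj]
    simp only [smul_eq_C_mul, C_mul, C_neg]
    ring
  linear_combination -e₃

theorem expOp_X_pow (α β : ℝ) (n : ℕ) :
    expOp (hermiteExponent α β) (X ^ n) = shiftedHermite α β n := by
  induction n with
  | zero =>
    rw [pow_zero, shiftedHermite_zero, expOp_eq_sum α β (N := 1) (by simp)]
    simp
  | succ n ih => rw [pow_succ', expOp_X_mul, ih, shiftedHermite_succ]

theorem diffOp_eq_smul_expOp {γ : ℕ → ℂ} {α β : ℝ}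
    (h : ∀ n, diffOp γ (X ^ n) = C (γ 0) * shiftedHermite α β n) (p : ℂ[X]) :
    diffOp γ p = C (γ 0) * expOp (hermiteExponent α β) p := by
  induction p using Polynomial.induction_on' with
  | add p q hp hq => rw [map_add, hp, hq, expOp_add, mul_add]
  | monomial n a =>
    rw [← C_mul_X_pow_eq_monomial, ← smul_eq_C_mul, map_smul, h, expOp_smul, expOp_X_pow,
      mul_smul_comm]

/-! ### Real-rootedness -/

theorem IsRealRooted.ne_zero {p : ℂ[X]} (h : IsRealRooted p) : p ≠ 0 := by
  rintro rfl
  simpa using h Complex.I (by simp)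

theorem pow_card_le_norm_prod_sub (z : ℂ) (s : Multiset ℂ) (h : ∀ r ∈ s, r.im = 0) :
    |z.im| ^ s.card ≤ ‖(s.map fun r => z - r).prod‖ := by
  induction s using Multiset.induction_on with
  | empty => simp
  | cons a s ih =>
    rw [Multiset.card_cons, Multiset.map_cons, Multiset.prod_cons, norm_mul, pow_succ']
    refine mul_le_mul ?_ (ih fun r hr => h r (Multiset.mem_cons_of_mem hr)) (by positivity)
      (norm_nonneg _)
    simpa [h a (Multiset.mem_cons_self a s)] using Complex.abs_im_le_norm (z - a)

/-- Each factor `z - r` with `r` real has modulus at least `|Im z|`. The bound depends only on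
degree and leading coefficient, so it survives limits that fix both. -/
theorem IsRealRooted.norm_eval_ge {p : ℂ[X]} (h : IsRealRooted p) (z : ℂ) :
    ‖p.leadingCoeff‖ * |z.im| ^ p.natDegree ≤ ‖p.eval z‖ := by
  have hs := IsAlgClosed.splits p
  rw [hs.eval_eq_prod_roots, norm_mul, hs.natDegree_eq_card_roots]
  refine mul_le_mul_of_nonneg_left (pow_card_le_norm_prod_sub z _ fun r hr => ?_) (norm_nonneg _)
  exact h r (isRoot_of_mem_roots hr)

/-- For real `r`, `Im (1 / (z - r)) = -Im z / |z - r|²`, so the summands never cancel; `t` is the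
sum of the `|z - r|⁻²`. -/
theorem im_sum_one_div_sub (z : ℂ) (s : Multiset ℂ) (h : ∀ r ∈ s, r.im = 0) :
    ∃ t : ℝ, 0 ≤ t ∧ ((s.map fun r => 1 / (z - r)).sum).im = -z.im * t ∧
      (z.im ≠ 0 → s ≠ 0 → 0 < t) := by
  induction s using Multiset.induction_on with
  | empty => exact ⟨0, le_rfl, by simp, by simp⟩
  | cons a s ih =>
    obtain ⟨t, ht, hsum, -⟩ := ih fun r hr => h r (Multiset.mem_cons_of_mem hr)
    have ha := h a (Multiset.mem_cons_self a s)
    refine ⟨(Complex.normSq (z - a))⁻¹ + t,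
      add_nonneg (inv_nonneg.mpr (Complex.normSq_nonneg _)) ht, ?_, fun hz _ => ?_⟩
    · rw [Multiset.map_cons, Multiset.sum_cons, Complex.add_im, hsum, one_div, Complex.inv_im,
        Complex.sub_im, ha]
      ring
    · refine add_pos_of_pos_of_nonneg (inv_pos.mpr (Complex.normSq_pos.mpr ?_)) ht
      intro h0
      have := congrArg Complex.im h0
      rw [Complex.sub_im, ha] at this
      exact hz (by simpa using this)

/-- A non-real zero would force `a p'/p = 1` there, but `p'/p = ∑ 1 / (z - r)` is not real off the
real axis unless `p` has no roots. -/
theorem IsRealRooted.sub_smul_derivative {p : ℂ[X]} (h : IsRealRooted p) (a : ℝ) :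
    IsRealRooted (p - (a : ℂ) • derivative p) := by
  intro z hz
  by_contra him
  have hpz : p.eval z ≠ 0 := fun h0 => him (h z h0)
  have hs := IsAlgClosed.splits p
  have hdiv := hs.eval_derivative_div_eval_of_ne_zero hpz
  obtain ⟨t, -, hsum, ht⟩ := im_sum_one_div_sub z p.roots
    fun r hr => h r (isRoot_of_mem_roots hr)
  rw [← hdiv] at hsum
  have hone : (a : ℂ) * (p.derivative.eval z / p.eval z) = 1 := by
    rw [eval_sub, eval_smul, smul_eq_mul, sub_eq_zero] at hz
    rw [← mul_div_assoc, ← hz, div_self hpz]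
  have ha : a ≠ 0 := by
    rintro rfl
    simp at hone
  have hroots : p.roots ≠ 0 := by
    intro h0
    rw [hdiv, h0] at hone
    simp at hone
  have := congrArg Complex.im hone
  rw [Complex.im_ofReal_mul, hsum, Complex.one_im] at this
  have htp := (ht him hroots).ne'
  simp_all

theorem natDegree_leadingCoeff_sub_smul_derivative (p : ℂ[X]) (a : ℂ) :
    (p - a • derivative p).natDegree = p.natDegree ∧
      (p - a • derivative p).leadingCoeff = p.leadingCoeff := by
  rcases eq_or_ne p 0 with rfl | hp
  · simp
  have hlt : (a • derivative p).degree < p.degree :=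
    (degree_smul_le _ _).trans_lt (degree_derivative_lt hp)
  exact ⟨natDegree_eq_of_degree_eq (degree_sub_eq_left_of_degree_lt hlt),
    leadingCoeff_sub_of_degree_lt hlt⟩

/-- Real-rootedness together with a prescribed degree and leading coefficient. -/
def IsRealRootedWith (d : ℕ) (c : ℂ) (p : ℂ[X]) : Prop :=
  IsRealRooted p ∧ p.natDegree = d ∧ p.leadingCoeff = c

theorem IsRealRootedWith.sub_smul_derivative {d : ℕ} {c : ℂ} {p : ℂ[X]}
    (h : IsRealRootedWith d c p) (a : ℝ) :
    IsRealRootedWith d c (p - (a : ℂ) • derivative p) := by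
  obtain ⟨h₁, h₂⟩ := natDegree_leadingCoeff_sub_smul_derivative p a
  exact ⟨h.1.sub_smul_derivative a, h₁.trans h.2.1, h₂.trans h.2.2⟩

theorem IsRealRootedWith.one_add_smul_hermiteExponent {d : ℕ} {c : ℂ} {p : ℂ[X]}
    (h : IsRealRootedWith d c p) {α : ℝ} (hα : 0 ≤ α) (β : ℝ) {t : ℝ} (ht : 0 ≤ t) :
    IsRealRootedWith d c ((1 + (t : ℂ) • hermiteExponent α β) p) := by
  -- `1 + t T = (1 - a D)(1 - b D)` with `a + b = t β` and `a b = -t α / 2`; this is the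
  -- discriminant.
  have hdisc : 0 ≤ (t * β) ^ 2 + 2 * t * α := by positivity
  have hsq := Real.sq_sqrt hdisc
  set s := Real.sqrt ((t * β) ^ 2 + 2 * t * α)
  have key := (h.sub_smul_derivative ((t * β + s) / 2)).sub_smul_derivative ((t * β - s) / 2)
  convert key using 1
  have e₁ : (C (((t * β + s) / 2 : ℝ) : ℂ) : ℂ[X]) + C (((t * β - s) / 2 : ℝ) : ℂ) =
      C (t : ℂ) * C (β : ℂ) := by
    rw [← C_mul, ← C_add]
    congr 1
    push_cast
    ring
  have e₂ : (C (((t * β - s) / 2 : ℝ) : ℂ) : ℂ[X]) * C (((t * β + s) / 2 : ℝ) : ℂ) =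
      -(C (t : ℂ) * C ((α : ℂ) / 2)) := by
    rw [← C_mul, ← C_mul, ← C_neg]
    congr 1
    have : ((t * β - s) / 2) * ((t * β + s) / 2) = -(t * (α / 2)) := by linear_combination -hsq / 4
    exact_mod_cast this
  simp only [hermiteExponent, LinearMap.add_apply, Module.End.one_apply, LinearMap.smul_apply,
    LinearMap.sub_apply, sq, Module.End.mul_apply, smul_eq_C_mul, C_neg, derivative_sub,
    derivative_C_mul]
  linear_combination derivative p * e₁ - derivative (derivative p) * e₂

theorem IsRealRootedWith.one_add_smul_hermiteExponent_pow {d : ℕ} {c : ℂ} {p : ℂ[X]}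
    (h : IsRealRootedWith d c p) {α : ℝ} (hα : 0 ≤ α) (β : ℝ) {t : ℝ} (ht : 0 ≤ t) (n : ℕ) :
    IsRealRootedWith d c (((1 + (t : ℂ) • hermiteExponent α β) ^ n) p) := by
  induction n with
  | zero => simpa using h
  | succ n ih =>
    rw [pow_succ', Module.End.mul_apply]
    exact ih.one_add_smul_hermiteExponent hα β ht

/-- The range of summation does not depend on `n`, so limits can be taken term by term. -/
theorem one_add_smul_hermiteExponent_pow_apply (α β : ℝ) (t : ℂ) (p : ℂ[X]) (n : ℕ) :
    ((1 + t • hermiteExponent α β) ^ n) p = ∑ j ∈ Finset.range (p.natDegree + 1),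
      ((n.choose j : ℂ) * t ^ j) • (hermiteExponent α β ^ j) p := by
  have hsum : ∀ N, n < N → ((1 + t • hermiteExponent α β) ^ n) p = ∑ j ∈ Finset.range N,
      ((n.choose j : ℂ) * t ^ j) • (hermiteExponent α β ^ j) p := by
    intro N hN
    rw [add_comm, (Commute.one_right _).add_pow, LinearMap.sum_apply]
    refine (Finset.sum_subset (Finset.range_mono hN) fun j _ hj => ?_).trans
      (Finset.sum_congr rfl fun j _ => ?_)
    · have : n < j := by simpa using hj
      simp [Nat.choose_eq_zero_of_lt this]
    · rw [one_pow, mul_one, _root_.smul_pow, ← nsmul_eq_mul', LinearMap.smul_apply,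
        LinearMap.smul_apply, mul_smul, Nat.cast_smul_eq_nsmul]
  rw [hsum (max (n + 1) (p.natDegree + 1)) (by omega)]
  refine (Finset.sum_subset (Finset.range_mono (le_max_right _ _)) fun j _ hj => ?_).symm
  have : p.natDegree < j := by simpa using hj
  rw [hermiteExponent_pow_apply_eq_zero α β this, smul_zero]

open Filter Topology in
theorem tendsto_choose_mul_inv_pow (j : ℕ) :
    Tendsto (fun n : ℕ => (n.choose j : ℂ) * (((n : ℝ)⁻¹ : ℝ) : ℂ) ^ j) atTop
      (𝓝 (1 / (j.factorial : ℂ))) := by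
  have hlim : Tendsto (fun n : ℕ => (n : ℝ) * (n : ℝ)⁻¹) atTop (𝓝 1) := by
    refine tendsto_const_nhds.congr' ?_
    filter_upwards [eventually_ne_atTop 0] with n hn
    rw [mul_inv_cancel₀ (by exact_mod_cast hn)]
  have := (Complex.continuous_ofReal.tendsto _).comp
    (ProbabilityTheory.tendsto_choose_mul_pow_atTop j hlim)
  simpa [Function.comp_def] using this

open Filter Topology in
theorem tendsto_eval_one_add_smul_hermiteExponent_pow (α β : ℝ) (p : ℂ[X]) (z : ℂ) :
    Tendsto (fun n : ℕ =>
        (((1 + (((n : ℝ)⁻¹ : ℝ) : ℂ) • hermiteExponent α β) ^ n) p).eval z) atTop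
      (𝓝 ((expOp (hermiteExponent α β) p).eval z)) := by
  simp only [one_add_smul_hermiteExponent_pow_apply,
    expOp_eq_sum α β (Nat.lt_succ_self p.natDegree), eval_finsetSum, eval_smul]
  exact tendsto_finsetSum _ fun j _ => (tendsto_choose_mul_inv_pow j).smul_const _

theorem IsRealRooted.expOp_hermiteExponent {p : ℂ[X]} (h : IsRealRooted p) {α : ℝ} (hα : 0 ≤ α)
    (β : ℝ) : IsRealRooted (expOp (hermiteExponent α β) p) := by
  intro z hz
  by_contra him
  have hlim := (tendsto_eval_one_add_smul_hermiteExponent_pow α β p z).norm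
  have hle : ‖p.leadingCoeff‖ * |z.im| ^ p.natDegree ≤
      ‖(expOp (hermiteExponent α β) p).eval z‖ := by
    -- The approximants share the degree and leading coefficient of `p`, hence one lower bound; this
    -- replaces Hurwitz's theorem.
    refine ge_of_tendsto' hlim fun n => ?_
    obtain ⟨h₁, h₂, h₃⟩ :=
      (show IsRealRootedWith p.natDegree p.leadingCoeff p from
        ⟨h, rfl, rfl⟩).one_add_smul_hermiteExponent_pow hα β
          (t := (n : ℝ)⁻¹) (by positivity) n
    simpa only [h₂, h₃] using h₁.norm_eval_ge z
  rw [hz, norm_zero] at hle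
  have : 0 < ‖p.leadingCoeff‖ := norm_pos_iff.mpr (leadingCoeff_ne_zero.mpr h.ne_zero)
  have := abs_pos.mpr him
  exact absurd hle (not_le.mpr (by positivity))

/-! ### The Gaussian functional -/

section Gaussian

open MeasureTheory ProbabilityTheory
open scoped NNReal

theorem integrable_eval_gaussianReal (β : ℝ) (v : ℝ≥0) (p : ℂ[X]) :
    Integrable (fun x : ℝ => p.eval (x : ℂ)) (gaussianReal β v) := by
  induction p using Polynomial.induction_on' with
  | add p q hp hq =>
    exact (hp.add hq).congr (Filter.Eventually.of_forall fun x => by simp)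
  | monomial n a =>
    simp only [eval_monomial]
    refine Integrable.const_mul ?_ a
    have hn : Integrable (fun x : ℝ => ‖x‖ ^ n) (gaussianReal β v) :=
      (memLp_id_gaussianReal (μ := β) (v := v) n).integrable_norm_pow'
    refine hn.mono' (by fun_prop) (Filter.Eventually.of_forall fun x => ?_)
    simp

/-- Integration of polynomials against the Gaussian of mean `β` and variance `v`. -/
noncomputable def gaussianFunctional (β : ℝ) (v : ℝ≥0) : ℂ[X] →ₗ[ℂ] ℂ where
  toFun p := ∫ x : ℝ, p.eval (x : ℂ) ∂gaussianReal β v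
  map_add' p q := by
    simp only [eval_add]
    exact integral_add (integrable_eval_gaussianReal β v p) (integrable_eval_gaussianReal β v q)
  map_smul' c p := by
    simp only [eval_smul, RingHom.id_apply]
    exact integral_smul c _

theorem gaussianFunctional_apply (β : ℝ) (v : ℝ≥0) (p : ℂ[X]) :
    gaussianFunctional β v p = ∫ x : ℝ, p.eval (x : ℂ) ∂gaussianReal β v := rfl

theorem gaussianFunctional_one (β : ℝ) (v : ℝ≥0) : gaussianFunctional β v 1 = 1 := by
  simp [gaussianFunctional_apply]

/-- The integrand is non-negative with finitely many zeros, and the Gaussian has no atoms. -/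
theorem isPositiveDefinite_gaussianFunctional (β : ℝ) {v : ℝ≥0} (hv : v ≠ 0) :
    IsPositiveDefinite (gaussianFunctional β v) := by
  intro p hp hpos
  have hre : ∀ x : ℝ, p.eval (x : ℂ) = (((p.eval (x : ℂ)).re : ℝ) : ℂ) := fun x =>
    Complex.ext rfl (by simpa using (Complex.le_def.mp (hpos x)).2.symm)
  have hnn : ∀ x : ℝ, 0 ≤ (p.eval (x : ℂ)).re := fun x => (Complex.le_def.mp (hpos x)).1
  have hint := (integrable_eval_gaussianReal β v p).re
  rw [gaussianFunctional_apply, integral_congr_ae (Filter.Eventually.of_forall hre),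
    integral_complex_ofReal]
  refine Complex.zero_lt_real.mpr ((integral_pos_iff_support_of_nonneg hnn hint).mpr ?_)
  have hfin : {x : ℝ | (p.eval (x : ℂ)).re = 0}.Finite := by
    refine ((p.roots.toFinset.finite_toSet).preimage
      (f := ((↑) : ℝ → ℂ)) Complex.ofReal_injective.injOn).subset fun x hx => ?_
    have hx : (p.eval (x : ℂ)).re = 0 := hx
    have : p.eval (x : ℂ) = 0 := by rw [hre, hx, Complex.ofReal_zero]
    simpa [hp] using this
  have := nullSingletonClass_gaussianReal (μ := β) hv
  have hzero : gaussianReal β v {x : ℝ | (p.eval (x : ℂ)).re = 0} = 0 := hfin.measure_zero _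
  have hsupp : Function.support (fun x : ℝ => (p.eval (x : ℂ)).re) =
      {x : ℝ | (p.eval (x : ℂ)).re = 0}ᶜ := rfl
  rw [hsupp, (prob_compl_eq_one_iff hfin.measurableSet).mpr hzero]
  exact one_pos

theorem hasDerivAt_gaussianPDFReal (β : ℝ) (v : ℝ≥0) (x : ℝ) :
    HasDerivAt (gaussianPDFReal β v) (-(x - β) / v * gaussianPDFReal β v x) x := by
  have h : HasDerivAt (fun x : ℝ => -(x - β) ^ 2 / (2 * v)) (-(2 * (x - β)) / (2 * v)) x := by
    simpa using ((((hasDerivAt_id x).sub_const β).pow 2).neg).div_const (2 * (v : ℝ))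
  have h' := h.exp.const_mul (Real.sqrt (2 * Real.pi * v))⁻¹
  refine h'.congr_deriv ?_
  rw [gaussianPDFReal, neg_div, neg_div, mul_div_mul_left _ _ (two_ne_zero)]
  ring

theorem integrable_gaussianPDFReal_smul_eval (β : ℝ) {v : ℝ≥0} (hv : v ≠ 0) (p : ℂ[X]) :
    Integrable (fun x : ℝ => gaussianPDFReal β v x • p.eval (x : ℂ)) := by
  have h := integrable_eval_gaussianReal β v p
  rw [gaussianReal_of_var_ne_zero β hv, integrable_withDensity_iff_integrable_smul'
    (measurable_gaussianPDF β v) (Filter.Eventually.of_forall fun _ => gaussianPDF_lt_top)] at h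
  simpa only [toReal_gaussianPDF] using h

/-- Gaussian integration by parts. -/
theorem gaussianFunctional_X_sub_C_mul (β : ℝ) {v : ℝ≥0} (hv : v ≠ 0) (q : ℂ[X]) :
    gaussianFunctional β v ((X - C (β : ℂ)) * q) =
      ((v : ℝ) : ℂ) * gaussianFunctional β v (derivative q) := by
  have hv' : ((v : ℝ) : ℂ) ≠ 0 := by exact_mod_cast hv
  -- Chosen so that density times `r` is the derivative of density times `q`, and so integrates to
  -- zero.
  set r : ℂ[X] := derivative q - C ((v : ℝ) : ℂ)⁻¹ * ((X - C (β : ℂ)) * q) with hr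
  have hderiv : ∀ x : ℝ, HasDerivAt (fun x : ℝ => gaussianPDFReal β v x • q.eval (x : ℂ))
      (gaussianPDFReal β v x • r.eval (x : ℂ)) x := by
    intro x
    refine ((hasDerivAt_gaussianPDFReal β v x).smul (q.hasDerivAt (x : ℂ)).comp_ofReal).congr_deriv
      ?_
    simp [hr]
    field_simp
    ring
  have h0 := integral_eq_zero_of_hasDerivAt_of_integrable hderiv
    (integrable_gaussianPDFReal_smul_eval β hv r) (integrable_gaussianPDFReal_smul_eval β hv q)
  rw [← integral_gaussianReal_eq_integral_smul hv, ← gaussianFunctional_apply, hr, map_sub,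
    ← smul_eq_C_mul, map_smul, smul_eq_mul, sub_eq_zero] at h0
  rw [h0, mul_inv_cancel_left₀ hv']

/-- Under the Gaussian pairing the raising operator is the transpose of `v D`. Orthogonality follows
by taking `deg q < n`. -/
theorem gaussianFunctional_shiftedHermite_mul (β : ℝ) {v : ℝ≥0} (hv : v ≠ 0) (n : ℕ) (q : ℂ[X]) :
    gaussianFunctional β v (shiftedHermite v β n * q) =
      ((v : ℝ) : ℂ) ^ n * gaussianFunctional β v (derivative^[n] q) := by
  induction n generalizing q with
  | zero => simp [shiftedHermite_zero]
  | succ n ih =>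
    have e : shiftedHermite v β (n + 1) * q = (X - C (β : ℂ)) * (shiftedHermite v β n * q) -
        ((v : ℝ) : ℂ) • (derivative (shiftedHermite v β n) * q) := by
      rw [shiftedHermite_succ, smul_eq_C_mul]
      ring
    rw [e, map_sub, gaussianFunctional_X_sub_C_mul β hv, map_smul, derivative_mul, map_add,
      ih, smul_eq_mul, Function.iterate_succ_apply]
    ring

theorem isOPS_shiftedHermite (β : ℝ) {v : ℝ≥0} (hv : v ≠ 0) {c : ℂ} (hc : c ≠ 0) :
    IsOPS (gaussianFunctional β v) fun n => C c * shiftedHermite v β n := by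
  have hlt : ∀ m n, n < m →
      gaussianFunctional β v (shiftedHermite v β m * shiftedHermite v β n) = 0 := by
    intro m n hmn
    rw [gaussianFunctional_shiftedHermite_mul β hv, iterate_derivative_eq_zero, map_zero, mul_zero]
    rwa [(shiftedHermite_monic_natDegree v β n).2]
  have hmul : ∀ m n, C c * shiftedHermite v β m * (C c * shiftedHermite v β n) =
      (c * c) • (shiftedHermite v β m * shiftedHermite v β n) := fun m n => by
    rw [smul_eq_C_mul, C_mul]
    ring
  refine ⟨fun n => ?_, fun m n hmn => ?_, fun n => ?_⟩
  · obtain ⟨hm, hd⟩ := shiftedHermite_monic_natDegree v β n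
    rw [degree_C_mul hc, degree_eq_natDegree hm.ne_zero, hd]
  · rw [hmul, map_smul]
    rcases lt_or_gt_of_ne hmn with h | h
    · rw [mul_comm (shiftedHermite _ _ _), hlt n m h, smul_zero]
    · rw [hlt m n h, smul_zero]
  · obtain ⟨hm, hd⟩ := shiftedHermite_monic_natDegree v β n
    have hder : derivative^[n] (shiftedHermite v β n) = C (n.factorial : ℂ) := by
      have hdeg : (derivative^[n] (shiftedHermite v β n)).natDegree = 0 := by
        have := natDegree_iterate_derivative (shiftedHermite v β n) n
        omega
      have hcoeff := hm.coeff_natDegree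
      rw [hd] at hcoeff
      rw [eq_C_of_natDegree_eq_zero hdeg, coeff_iterate_derivative, zero_add,
        Nat.descFactorial_self, hcoeff]
      simp
    have hv' : ((v : ℝ) : ℂ) ≠ 0 := by exact_mod_cast hv
    have hf : (n.factorial : ℂ) ≠ 0 := by exact_mod_cast n.factorial_ne_zero
    simp only [sq]
    rw [hmul, map_smul, gaussianFunctional_shiftedHermite_mul β hv, hder, ← mul_one (C _),
      ← smul_eq_C_mul, map_smul, gaussianFunctional_one]
    simp only [smul_eq_mul, mul_one]
    exact mul_ne_zero (mul_ne_zero hc hc) (mul_ne_zero (pow_ne_zero _ hv') hf)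

end Gaussian

theorem mainTheorem3 (γ : ℕ → ℂ) :
    ((∃ 𝓛 : ℂ[X] →ₗ[ℂ] ℂ, IsPositiveDefinite 𝓛 ∧ IsOPS 𝓛 (fun n => diffOp γ (X ^ n))) ↔
      (∃ α β : ℝ, 0 < α ∧ γ 0 ≠ 0 ∧
        ∀ n : ℕ, diffOp γ (X ^ n) = C (γ 0) * (genHermite α n).comp (X - C (β : ℂ)))) ∧
    (∀ α β : ℝ, 0 < α → γ 0 ≠ 0 →
      (∀ n : ℕ, diffOp γ (X ^ n) = C (γ 0) * (genHermite α n).comp (X - C (β : ℂ))) →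
      (∀ n : ℕ, C (γ 0) * (genHermite α n).comp (X - C (β : ℂ)) =
        C (γ 0) * expOp (-((α : ℂ) / 2) • opD ^ 2 - (β : ℂ) • opD) (X ^ n)) ∧
      PreservesRealRootedness (diffOp γ)) := by
  refine ⟨⟨fun ⟨𝓛, h𝓛, hP⟩ => hP.exists_eq_shiftedHermite h𝓛, ?_⟩, fun α β hα hγ h => ⟨?_, ?_⟩⟩
  · rintro ⟨α, β, hα, hγ, h⟩
    -- `α` becomes the variance of the Gaussian.
    lift α to NNReal using hα.le
    have hv : α ≠ 0 := by exact_mod_cast hα.ne'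
    refine ⟨gaussianFunctional β α, isPositiveDefinite_gaussianFunctional β hv, ?_⟩
    rw [funext h]
    exact isOPS_shiftedHermite β hv hγ
  · exact fun n => congrArg (C (γ 0) * ·) (expOp_X_pow α β n).symm
  · intro p hp z hz
    rw [diffOp_eq_smul_expOp h, eval_mul, eval_C] at hz
    exact hp.expOp_hermiteExponent hα.le β z ((mul_eq_zero.mp hz).resolve_left hγ)
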